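/- Let $P$ be a simple polygon in the plane with edge set $E$, and let $\delta\colon E\to\mathbb{R}^+_0$ be additive weights. The wavefront $\mathcal{W}_{P,\delta}(t)$ is a finite set of simple polygons that evolves with time $t\ge 0$ as follows. $\mathcal{W}_{P,\delta}(0)$ is $P$. Every wavefront edge is a fragment of an edge $e$ of $P$, oriented as $e$, and at time $t$ it lies on $\overline{e}+\max(0,t-\delta(e))\cdot n_e$, where $\overline{e}$ is the supporting line of $e$ and $n_e$ its inward unit normal. Incidences are preserved between finitely many event times, so that a wavefront vertex is the common point of the two moved supporting lines of its incident edges (if these lines coincide, with equal orientation, the vertex moves perpendicularly to them). At an event time, edges that have shrunk to length zero are removed; portions common to two oppositely oriented parallel edges that have moved into each other are removed; all other portions of edges stay; and polygons that touch themselves are split at the points of contact, so that all wavefront polygons are simple again. The process ends when the wavefront is empty. We assume that $(P,\delta)$ admits such a propagation process. The additively-weighted straight skeleton $\mathcal{S}(P,\delta)$ is the union of the traces of all wavefront vertices over the propagation period and of all portions common to two parallel wavefront edges that move into each other. For $t\ge 0$, let $\mathcal{S}_{P,\delta}(t)$ be the portion of $\mathcal{S}(P,\delta)$ traced until time $t$,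 and regard $\mathcal{W}_{P,\delta}(t)$ as the union of its edges. Let $t\ge 0$. If two points $p,q\in\mathcal{S}_{P,\delta}(t)$ are path-connected in $\mathcal{S}_{P,\delta}(t)\cup\mathcal{W}_{P,\delta}(t)$, then they are path-connected in $\mathcal{S}(P,\delta)$. -/

import Mathlib

namespace StraightSkeleton

/-!
The plane is identified with `ℂ`.  A family of closed polygons is given by a permutation `next`
of its vertices; its cycles are the polygons, and the edge of a vertex `v` is the segment from
`v` to `next v`.
-/

/-- The closed edge from the vertex `v` to its successor. -/
def edgeSeg {V : Type} (next : Equiv.Perm V) (x : V → ℂ) (v : V) : Set ℂ :=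
  segment ℝ (x v) (x (next v))

/-- Every cycle of `next` is a simple polygon: edges have positive length, and two different
edges of one polygon share no point except the common vertex of two consecutive edges. -/
def IsSimple {V : Type} (next : Equiv.Perm V) (x : V → ℂ) : Prop :=
  (∀ v, x v ≠ x (next v)) ∧
  ∀ v w, next.SameCycle v w → v ≠ w → ∀ z ∈ edgeSeg next x v ∩ edgeSeg next x w,
    (w = next v ∧ z = x w) ∨ (v = next w ∧ z = x v)

/-- A simple polygon whose vertices are listed counterclockwise (its signed area is positive),
so that the interior lies to the left of every edge.  Edge `i` joins the vertices `i` and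
`i + 1` (cyclically). -/
structure SimplePolygon (n : ℕ) extends Polygon ℂ n where
  three_le : 3 ≤ n
  simple : IsSimple (finRotate n) vertices
  ccw : 0 < ∑ i, ((vertices i).re * (vertices (finRotate n i)).im
    - (vertices i).im * (vertices (finRotate n i)).re)

namespace SimplePolygon

variable {n : ℕ} (P : SimplePolygon n)

/-- Unit direction of the polygon edge `e`. -/
noncomputable def dir (e : Fin n) : ℂ :=
  (‖P.vertices (finRotate n e) - P.vertices e‖⁻¹ : ℝ) •
    (P.vertices (finRotate n e) - P.vertices e)

/-- Inward unit normal of the polygon edge `e`: the direction turned left by a right angle. -/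
noncomputable def normal (e : Fin n) : ℂ := Complex.I * P.dir e

end SimplePolygon

/-- Distance that an edge with additive weight `d` has moved by time `t`. -/
noncomputable def offset (d : NNReal) (t : ℝ) : ℝ := max 0 (t - d)

/-- The supporting line of the polygon edge `e`, moved to its position at time `t`:
`ē + max(0, t - δ(e)) · n_e`. -/
noncomputable def movedLine {n : ℕ} (P : SimplePolygon n) (δ : Fin n → NNReal) (e : Fin n)
    (t : ℝ) : Set ℂ :=
  {z | ∃ r : ℝ, z = P.vertices e + r • P.dir e + offset (δ e) t • P.normal e}

/-- A moving family of polygons with a fixed combinatorial structure.  The vertices are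
`Fin m` (the family is empty if `m = 0`), the polygons are the cycles of `next`, the edge from
`v` to `next v` is a fragment of the polygon edge `label v`, and `pos v t` is the location of
the vertex `v` at time `t`. -/
structure KineticWavefront (n : ℕ) where
  m : ℕ
  next : Equiv.Perm (Fin m)
  label : Fin m → Fin n
  pos : Fin m → ℝ → ℂ

namespace KineticWavefront

variable {n : ℕ} (K : KineticWavefront n)

/-- The wavefront edge from `v` to its successor at time `t`. -/
def edge (v : Fin K.m) (t : ℝ) : Set ℂ := edgeSeg K.next (fun u => K.pos u t) v

/-- The portion common to the wavefront edges of `v` and `w` at time `t`, if these two edges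
are parallel with opposite orientation (so that they move into each other). -/
def common (P : SimplePolygon n) (v w : Fin K.m) (t : ℝ) : Set ℂ :=
  {z | P.dir (K.label w) = - P.dir (K.label v) ∧ z ∈ K.edge v t ∧ z ∈ K.edge w t}

/-- Propagation without a combinatorial change from time `a` to time `b`: each wavefront edge
is a fragment of the moved supporting line of its polygon edge, incidences are preserved, and
up to (not including) time `b` every wavefront edge has positive length, is oriented as its
polygon edge, and every wavefront polygon is simple. (The bounded regions of different
wavefront polygons are disjoint and shrink, so different wavefront polygons do not interact.)

The two supporting lines determine a vertex, unless they are the same line for two edges with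
the same orientation; such a vertex (interior angle `180°`) moves perpendicularly to them. -/
structure Propagates (P : SimplePolygon n) (δ : Fin n → NNReal) (a b : ℝ) : Prop where
  continuousOn : ∀ v, ContinuousOn (K.pos v) (Set.Icc a b)
  on_line : ∀ v, ∀ t ∈ Set.Icc a b,
    K.pos v t ∈ movedLine P δ (K.label v) t ∧ K.pos (K.next v) t ∈ movedLine P δ (K.label v) t
  straight_angle : ∀ v, P.dir (K.label (K.next v)) = P.dir (K.label v) → ∀ t ∈ Set.Icc a b,
    K.pos (K.next v) t = K.pos (K.next v) a +
      (offset (δ (K.label v)) t - offset (δ (K.label v)) a) • P.normal (K.label v)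
  oriented : ∀ v, ∀ t ∈ Set.Ico a b, ∃ r : ℝ, 0 < r ∧
    K.pos (K.next v) t - K.pos v t = r • P.dir (K.label v)
  simple : ∀ t ∈ Set.Ico a b, IsSimple K.next (fun v => K.pos v t)

/-- The wavefront `K'` results from the wavefront `K` by the edge and split events (elementary
or not) at time `t`.  Each edge of `K'` is a portion of an edge of `K`, its parent.

* Edges of `K` that have shrunk to zero length are dropped (an edge of a propagating wavefront
  has positive length initially, so it cannot be the child of such an edge).
* Portions common to two edges that have moved into each other are dropped.
* Everything else stays in the wavefront, without overlaps.
* Polygons are split but never joined, and an edge is split only where its two portions become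
  nonadjacent.

Together with the simplicity of the polygons of `K'`, this says that a polygon which touches
itself is split at the points of contact. -/
def Event (P : SimplePolygon n) (K K' : KineticWavefront n) (t : ℝ) : Prop :=
  ∃ parent : Fin K'.m → Fin K.m,
    (∀ u, K'.label u = K.label (parent u)) ∧
    (∀ u, K'.edge u t ⊆ K.edge (parent u) t) ∧
    (∀ v, K.pos v t ≠ K.pos (K.next v) t → ∀ z ∈ K.edge v t,
      (∃ u, parent u = v ∧ z ∈ K'.edge u t) ∨ (∃ w, z ∈ K.common P v w t)) ∧
    (∀ u u', u ≠ u' → parent u = parent u' → (K'.edge u t ∩ K'.edge u' t).Subsingleton) ∧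
    (∀ u w, (K'.edge u t ∩ K.common P (parent u) w t).Subsingleton) ∧
    (∀ u u', K'.next.SameCycle u u' → K.next.SameCycle (parent u) (parent u')) ∧
    (∀ u, parent (K'.next u) ≠ parent u)

end KineticWavefront

/-- The wavefront propagation process of the simple polygon `P` with additive weights `δ`:
it starts at time `0` with `P` itself, propagates without combinatorial change between the
finitely many times `time 0 < ⋯ < time N`, is updated by the events at the times
`time 1, …, time N`, and ends at `time N` with the empty wavefront.  Speed changes are part of
`Propagates`, as they do not alter the combinatorial structure. -/
structure WavefrontPropagation {n : ℕ} (P : SimplePolygon n) (δ : Fin n → NNReal) where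
  N : ℕ
  time : ℕ → ℝ
  wave : ℕ → KineticWavefront n
  time_zero : time 0 = 0
  time_lt : ∀ i < N, time i < time (i + 1)
  start : ∃ φ : Fin n ≃ Fin (wave 0).m, ∀ i, (wave 0).next (φ i) = φ (finRotate n i) ∧
    (wave 0).label (φ i) = i ∧ (wave 0).pos (φ i) 0 = P.vertices i
  propagates : ∀ i < N, (wave i).Propagates P δ (time i) (time (i + 1))
  event : ∀ i < N, KineticWavefront.Event P (wave i) (wave (i + 1)) (time (i + 1))
  finish : (wave N).m = 0

namespace WavefrontPropagation

variable {n : ℕ} {P : SimplePolygon n} {δ : Fin n → NNReal} (W : WavefrontPropagation P δ)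

/-- The wavefront `𝓦_{P,δ}(t)` as a point set: the union of all wavefront edges at time `t`
(after the events at time `t`; it is empty from the end of the process on). -/
def wavefront (t : ℝ) : Set ℂ :=
  {z | ∃ i < W.N, W.time i ≤ t ∧ t < W.time (i + 1) ∧ ∃ v, z ∈ (W.wave i).edge v t}

/-- The portion `𝓢_{P,δ}(t)` of the straight skeleton traced until time `t`: the traces of the
wavefront vertices up to time `t`, and the portions common to two wavefront edges that have
moved into each other by time `t`. -/
def skeletonUntil (t : ℝ) : Set ℂ :=
  {z | ∃ i < W.N, ∃ v, ∃ s ∈ Set.Icc (W.time i) (W.time (i + 1)),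
      s ≤ t ∧ z = (W.wave i).pos v s} ∪
  {z | ∃ i < W.N, W.time (i + 1) ≤ t ∧
      ∃ v w, z ∈ (W.wave i).common P v w (W.time (i + 1))}

/-- The additively-weighted straight skeleton `𝓢(P, δ)`. -/
def skeleton : Set ℂ := ⋃ t : ℝ, W.skeletonUntil t

end WavefrontPropagation

end StraightSkeleton

/-! The hypothesis on `p` and `q` is stronger than needed: the whole skeleton is path-connected
(`isPathConnected_skeleton`). Backwards in time, the two endpoints of every wavefront edge are
joined in the skeleton. The final wavefront is empty. Just before an event, an edge of positive
length is covered by its child edges, whose endpoints are joined by induction, and by removed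
portions, which belong to the skeleton; connectedness of the segment chains these pieces together
(`exists_piece_of_chain`, `Event.joinedIn_next`). Hence all vertices of one wavefront polygon are
joined. Forwards in time, every polygon created by an event is tied to an old vertex. It has a
corner where the direction changes (`exists_dir_ne`). Either the two parent edges there are
opposite, and the corner lies in a removed portion containing an old vertex, or they cross
transversally, and the corner is itself an old vertex (`eq_endpoint_of_not_parallel`). So everything
is joined to a vertex of `P`. -/

namespace StraightSkeleton

open Set Filter Topology

/-! ### Segments and covers of connected sets -/

/-- Nontrivial members of a finite closed cover of a nontrivial connected `T1` space already
cover it. -/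
theorem exists_mem_not_subsingleton {X ι : Type*} [TopologicalSpace X] [ConnectedSpace X]
    [Nontrivial X] [T1Space X] [Finite ι] {A : ι → Set X} (hA : ∀ j, IsClosed (A j))
    (hcov : ∀ x, ∃ j, x ∈ A j) (x : X) : ∃ j, ¬ (A j).Subsingleton ∧ x ∈ A j := by
  set F : Set X := ⋃ j ∈ {j | (A j).Subsingleton}, A j
  set G : Set X := ⋃ j ∈ {j | ¬ (A j).Subsingleton}, A j
  have hF : F.Finite := (Set.toFinite _).biUnion fun j hj => hj.finite
  have hG : IsClosed G := (Set.toFinite _).isClosed_biUnion fun j _ => hA j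
  -- A nontrivial connected T1 space has no isolated points, so removing finitely many points leaves
  -- a dense set, which the closed set `G` contains.
  have hd : Dense (univ \ F) := dense_univ.sdiff_finite hF
  have hsub : univ \ F ⊆ G := by
    rintro y ⟨-, hy⟩
    obtain ⟨j, hj⟩ := hcov y
    by_cases hs : (A j).Subsingleton
    · exact absurd (mem_biUnion hs hj) hy
    · exact mem_biUnion (show j ∈ {j | ¬ (A j).Subsingleton} from hs) hj
  have : x ∈ G := hG.closure_subset_iff.2 hsub (hd x)
  simpa [G] using this

/-- If a nontrivial connected set is covered by finitely many closed pieces, then a property that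
passes from a nontrivial piece to every nontrivial piece meeting it, and that holds for the
nontrivial pieces through `a`, holds for some nontrivial piece through `b`. -/
theorem exists_piece_of_chain {X ι : Type*} [TopologicalSpace X] [T1Space X] [Finite ι]
    {s : Set X} (hs : IsPreconnected s) (hnt : s.Nontrivial) {A : ι → Set X}
    (hA : ∀ j, IsClosed (A j)) (hcov : ∀ x ∈ s, ∃ j, x ∈ A j) (good : ι → Prop)
    (hstep : ∀ j k, good j → ¬ (A j).Subsingleton → ¬ (A k).Subsingleton →
      (∃ x ∈ s, x ∈ A j ∧ x ∈ A k) → good k)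
    {a b : X} (ha : a ∈ s) (hb : b ∈ s)
    (hgood : ∀ j, ¬ (A j).Subsingleton → a ∈ A j → good j) :
    ∃ j, good j ∧ ¬ (A j).Subsingleton ∧ b ∈ A j := by
  have hcov' : ∀ x ∈ s, ∃ j, ¬ (A j).Subsingleton ∧ x ∈ A j := by
    have : PreconnectedSpace s := Subtype.preconnectedSpace hs
    have : ConnectedSpace s := { toNonempty := ⟨⟨a, ha⟩⟩ }
    have : Nontrivial s := hnt.coe_sort
    intro x hx
    obtain ⟨j, hj, hxj⟩ := exists_mem_not_subsingleton (X := s)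
      (A := fun j => Subtype.val ⁻¹' A j)
      (fun j => (hA j).preimage continuous_subtype_val) (fun y => hcov y y.2) ⟨x, hx⟩
    exact ⟨j, fun h => hj (h.preimage Subtype.val_injective), hxj⟩
  -- Otherwise the good and the bad nontrivial pieces form two closed sets covering `s`, one meeting
  -- it at `a` and the other at `b`. Connectedness gives a common point, where `hstep` fails.
  by_contra! hbad
  set G : Set X := ⋃ j ∈ {j | good j ∧ ¬ (A j).Subsingleton}, A j
  set B : Set X := ⋃ j ∈ {j | ¬ good j ∧ ¬ (A j).Subsingleton}, A j
  have hG : IsClosed G := (Set.toFinite _).isClosed_biUnion fun j _ => hA j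
  have hB : IsClosed B := (Set.toFinite _).isClosed_biUnion fun j _ => hA j
  have hGB : s ⊆ G ∪ B := by
    intro x hx
    obtain ⟨j, hj, hxj⟩ := hcov' x hx
    by_cases hg : good j
    · exact Or.inl (mem_biUnion (show j ∈ {j | good j ∧ ¬ (A j).Subsingleton} from ⟨hg, hj⟩) hxj)
    · exact Or.inr
        (mem_biUnion (show j ∈ {j | ¬ good j ∧ ¬ (A j).Subsingleton} from ⟨hg, hj⟩) hxj)
  have haG : (s ∩ G).Nonempty := by
    obtain ⟨j, hj, hxj⟩ := hcov' a ha
    exact ⟨a, ha, mem_biUnion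
      (show j ∈ {j | good j ∧ ¬ (A j).Subsingleton} from ⟨hgood j hj hxj, hj⟩) hxj⟩
  have hbB : (s ∩ B).Nonempty := by
    obtain ⟨j, hj, hxj⟩ := hcov' b hb
    exact ⟨b, hb, mem_biUnion (show j ∈ {j | ¬ good j ∧ ¬ (A j).Subsingleton} from
      ⟨fun hg => hbad j hg (not_subsingleton_iff.1 hj) hxj, hj⟩) hxj⟩
  obtain ⟨x, hxs, hxG, hxB⟩ := isPreconnected_closed_iff.1 hs G B hG hB hGB haG hbB
  simp only [G, B, mem_iUnion, mem_ofPred_eq, exists_prop] at hxG hxB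
  obtain ⟨j, ⟨hjg, hj⟩, hxj⟩ := hxG
  obtain ⟨k, ⟨hkg, hk⟩, hxk⟩ := hxB
  exact hkg (hstep j k hjg hj hk ⟨x, hxs, hxj, hxk⟩)

theorem isClosed_segment (a b : ℂ) : IsClosed (segment ℝ a b) := by
  rw [segment_eq_image_lineMap]
  exact (isCompact_Icc.image (by fun_prop)).isClosed

/-- An endpoint of a segment is an extreme point of it. -/
theorem eq_endpoint_of_endpoint_mem {a b p q : ℂ} (hp : p ∈ segment ℝ a b)
    (hq : q ∈ segment ℝ a b) (ha : a ∈ segment ℝ p q) : a = p ∨ a = q := by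
  rcases eq_or_ne a b with rfl | hab
  · rw [segment_same] at hp
    exact Or.inl hp.symm
  rw [segment_eq_image_lineMap] at hp hq
  obtain ⟨π, hπ, rfl⟩ := hp
  obtain ⟨ρ, hρ, rfl⟩ := hq
  rw [← image_segment, segment_eq_uIcc] at ha
  obtain ⟨α, hα, h⟩ := ha
  have h0 : α = 0 := AffineMap.lineMap_injective ℝ hab (by rw [h, AffineMap.lineMap_apply_zero])
  subst h0
  rcases le_total π ρ with hle | hle
  · rw [uIcc_of_le hle] at hα
    left
    rw [le_antisymm hα.1 hπ.1, AffineMap.lineMap_apply_zero]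
  · rw [uIcc_of_ge hle] at hα
    right
    rw [le_antisymm hα.1 hρ.1, AffineMap.lineMap_apply_zero]

/-- A nontrivial convex subset of a segment that shares a single point with a subsegment does so
at an endpoint of the subsegment. -/
theorem eq_endpoint_of_inter_subsingleton {a b p q x : ℂ} {C : Set ℂ} (hC : Convex ℝ C)
    (hCs : C ⊆ segment ℝ a b) (hCn : ¬ C.Subsingleton) (hp : p ∈ segment ℝ a b)
    (hq : q ∈ segment ℝ a b) (hI : (segment ℝ p q ∩ C).Subsingleton) (hxC : x ∈ C)
    (hx : x ∈ segment ℝ p q) : x = p ∨ x = q := by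
  obtain ⟨y, hyC, hyx⟩ := (not_subsingleton_iff.1 hCn).exists_ne x
  have hseg : segment ℝ x y ⊆ C := hC.segment_subset hxC hyC
  have hab : a ≠ b := by
    rintro rfl
    rw [segment_same] at hCs
    exact hyx ((hCs hyC).trans (hCs hxC).symm)
  have hinj := AffineMap.lineMap_injective ℝ hab
  have hy := hCs hyC
  rw [segment_eq_image_lineMap] at hp hq hy
  obtain ⟨π, -, rfl⟩ := hp
  obtain ⟨ρ, -, rfl⟩ := hq
  obtain ⟨η, -, rfl⟩ := hy
  rw [← image_segment, segment_eq_uIcc] at hx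
  obtain ⟨ξ, hξ, rfl⟩ := hx
  by_contra! hne
  have hξπ : ξ ≠ π := fun h => hne.1 (by rw [h])
  have hξρ : ξ ≠ ρ := fun h => hne.2 (by rw [h])
  have hηξ : η ≠ ξ := fun h => hyx (by rw [h])
  have key : ∀ ζ ∈ uIcc π ρ, ζ ∈ uIcc ξ η → ζ = ξ := by
    intro ζ h1 h2
    apply hinj
    refine hI ⟨?_, hseg ?_⟩ ⟨?_, hxC⟩
    · rw [← image_segment, segment_eq_uIcc]; exact mem_image_of_mem _ h1
    · rw [← image_segment, segment_eq_uIcc]; exact mem_image_of_mem _ h2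
    · rw [← image_segment, segment_eq_uIcc]; exact mem_image_of_mem _ hξ
  rw [mem_uIcc] at hξ
  simp only [mem_uIcc] at key
  -- From `ξ` towards `η`, stop at `η` or at the end of the subsegment, whichever comes first: this
  -- is a second common parameter.
  rcases lt_or_gt_of_ne hηξ with h | h
  · have := key (max η (min π ρ))
    grind
  · have := key (min η (max π ρ))
    grind

/-- If two segments on a common line meet, then an endpoint of one of them lies on the other. -/
theorem exists_endpoint_mem_inter {a b c e d z : ℂ} {r r' : ℝ} (hab : b - a = r • d)
    (hce : e - c = r' • d) (h1 : z ∈ segment ℝ a b) (h2 : z ∈ segment ℝ c e) :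
    ∃ y, (y = a ∨ y = b ∨ y = c ∨ y = e) ∧ y ∈ segment ℝ a b ∧ y ∈ segment ℝ c e := by
  have h1' := h1
  have h2' := h2
  rw [segment_eq_image'] at h1' h2'
  obtain ⟨θ, hθ, h1'⟩ := h1'
  obtain ⟨κ, hκ, h2'⟩ := h2'
  simp only [hab, hce, smul_smul] at h1' h2'
  -- One coordinate for both segments, with `z` at `0`. Injectivity is not needed, so `d`, `r` and
  -- `r'` may vanish.
  set f : ℝ →ᵃ[ℝ] ℂ := AffineMap.lineMap z (z + d) with hf
  have hfx : ∀ x, f x = z + x • d := by intro x; simp [hf, AffineMap.lineMap_apply, add_comm]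
  have ea : a = f (-(θ * r)) := by rw [hfx, neg_smul, ← h1']; abel
  have eb : b = f ((1 - θ) * r) := by
    rw [hfx, ← h1', sub_mul, sub_smul, one_mul, ← hab]; abel
  have ec : c = f (-(κ * r')) := by rw [hfx, neg_smul, ← h2']; abel
  have ee : e = f ((1 - κ) * r') := by
    rw [hfx, ← h2', sub_mul, sub_smul, one_mul, ← hce]; abel
  have h0 : (0 : ℝ) ∈ uIcc (-(θ * r)) ((1 - θ) * r) := by
    rw [mem_uIcc]
    rcases le_total 0 r with h | h
    · exact Or.inl ⟨by nlinarith [hθ.1], by nlinarith [hθ.2]⟩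
    · exact Or.inr ⟨by nlinarith [hθ.2], by nlinarith [hθ.1]⟩
  have h0' : (0 : ℝ) ∈ uIcc (-(κ * r')) ((1 - κ) * r') := by
    rw [mem_uIcc]
    rcases le_total 0 r' with h | h
    · exact Or.inl ⟨by nlinarith [hκ.1], by nlinarith [hκ.2]⟩
    · exact Or.inr ⟨by nlinarith [hκ.2], by nlinarith [hκ.1]⟩
  generalize -(θ * r) = α at *
  generalize (1 - θ) * r = β at *
  generalize -(κ * r') = γ at *
  generalize (1 - κ) * r' = ε at *
  have key : ∃ y : ℝ, (y = α ∨ y = β ∨ y = γ ∨ y = ε) ∧ y ∈ uIcc α β ∧ y ∈ uIcc γ ε := by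
    simp only [mem_uIcc] at *
    -- The left end of the intersection of the two intervals, which is nonempty since it contains
    -- `0`.
    refine ⟨max (min α β) (min γ ε), ?_, ?_, ?_⟩ <;> grind
  obtain ⟨y, hy, hy1, hy2⟩ := key
  refine ⟨f y, ?_, ?_, ?_⟩
  · rw [ea, eb, ec, ee]
    rcases hy with rfl | rfl | rfl | rfl <;> simp
  · rw [ea, eb, ← image_segment, segment_eq_uIcc]; exact mem_image_of_mem _ hy1
  · rw [ec, ee, ← image_segment, segment_eq_uIcc]; exact mem_image_of_mem _ hy2

/-! ### Directions of polygon edges -/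

theorem SimplePolygon.norm_dir {n : ℕ} (P : SimplePolygon n) (e : Fin n) : ‖P.dir e‖ = 1 := by
  have h : P.vertices (finRotate n e) - P.vertices e ≠ 0 :=
    sub_ne_zero.2 (P.simple.1 e).symm
  rw [SimplePolygon.dir, norm_smul, Real.norm_of_nonneg (by positivity),
    inv_mul_cancel₀ (norm_ne_zero_iff.2 h)]

/-- The component of `z` in the direction `d`. -/
noncomputable def along (d z : ℂ) : ℝ := d.re * z.re + d.im * z.im

/-- The cross product of two planar vectors. -/
noncomputable def cross (z w : ℂ) : ℝ := z.re * w.im - z.im * w.re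

@[fun_prop]
theorem continuous_along (d : ℂ) : Continuous (along d) := by
  unfold along; fun_prop

theorem continuous_cross_left (d : ℂ) : Continuous fun z => cross z d := by
  unfold cross; fun_prop

theorem along_sub (d z w : ℂ) : along d (z - w) = along d z - along d w := by
  simp only [along, Complex.sub_re, Complex.sub_im]; ring

theorem sq_add_sq_of_norm_eq_one {d : ℂ} (hd : ‖d‖ = 1) : d.re ^ 2 + d.im ^ 2 = 1 := by
  have := Complex.sq_norm d
  rw [hd, Complex.normSq_apply] at this
  linarith

theorem along_smul {d : ℂ} (hd : ‖d‖ = 1) (r : ℝ) : along d (r • d) = r := by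
  have := sq_add_sq_of_norm_eq_one hd
  simp only [along, Complex.smul_re, Complex.smul_im, smul_eq_mul]
  linear_combination r * this

/-- Unit vectors with vanishing cross product are equal or opposite. -/
theorem cross_ne_zero {d e : ℂ} (hd : ‖d‖ = 1) (he : ‖e‖ = 1) (h1 : e ≠ d) (h2 : e ≠ -d) :
    cross d e ≠ 0 := by
  intro h
  have hd' := sq_add_sq_of_norm_eq_one hd
  have he' := sq_add_sq_of_norm_eq_one he
  unfold cross at h
  -- Since `d` is a unit vector, a vanishing cross product makes `e` equal to its projection onto
  -- `d`; comparing norms then forces the coefficient to be `1` or `-1`.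
  have hre : e.re = along d e * d.re := by
    unfold along; linear_combination (-e.re) * hd' - d.im * h
  have him : e.im = along d e * d.im := by
    unfold along; linear_combination (-e.im) * hd' + d.re * h
  have hsq : (along d e - 1) * (along d e + 1) = 0 := by
    rw [hre, him] at he'
    linear_combination he' - along d e ^ 2 * hd'
  rcases mul_eq_zero.1 hsq with hc | hc
  · apply h1
    have hc : along d e = 1 := by linarith
    apply Complex.ext
    · rw [hre, hc, one_mul]
    · rw [him, hc, one_mul]
  · apply h2
    have hc : along d e = -1 := by linarith
    apply Complex.ext
    · rw [hre, hc, Complex.neg_re]; ring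
    · rw [him, hc, Complex.neg_im]; ring

/-- Lines with independent directions meet, in the point given by Cramer's rule. -/
theorem add_cross_smul_eq {a c d e : ℂ} (h : cross d e ≠ 0) :
    a + (cross (c - a) e / cross d e) • d = c + (cross (c - a) d / cross d e) • e := by
  apply Complex.ext
  · simp only [Complex.add_re, Complex.smul_re, smul_eq_mul]
    field_simp
    simp only [cross, Complex.sub_re, Complex.sub_im]
    ring
  · simp only [Complex.add_im, Complex.smul_im, smul_eq_mul]
    field_simp
    simp only [cross, Complex.sub_re, Complex.sub_im]
    ring

theorem mem_segment_of_sub_eq_smul {a b d : ℂ} {r l : ℝ} (h : b - a = r • d) (h0 : 0 ≤ l)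
    (hr : l < r) : a + l • d ∈ segment ℝ a b := by
  rw [segment_eq_image']
  refine ⟨l / r, ⟨div_nonneg h0 (h0.trans hr.le), (div_le_one (by linarith)).2 hr.le⟩, ?_⟩
  simp only [h, smul_smul]
  rw [div_mul_cancel₀ _ (by linarith : r ≠ 0)]

/-! ### Geometry of a single propagation phase. -/

namespace KineticWavefront

variable {n : ℕ} {K : KineticWavefront n} {P : SimplePolygon n} {δ : Fin n → NNReal} {a b : ℝ}

/-- Both endpoints lie on the same moved line. Unlike `oriented`, this also covers the final time
`b`, where the edge may have collapsed. -/
theorem Propagates.sub_eq_along_smul (h : K.Propagates P δ a b) (v : Fin K.m) {t : ℝ}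
    (ht : t ∈ Icc a b) :
    K.pos (K.next v) t - K.pos v t =
      along (P.dir (K.label v)) (K.pos (K.next v) t - K.pos v t) • P.dir (K.label v) := by
  obtain ⟨⟨r, hr⟩, ⟨r', hr'⟩⟩ := h.on_line v t ht
  have : K.pos (K.next v) t - K.pos v t = (r' - r) • P.dir (K.label v) := by
    rw [hr, hr', sub_smul]; abel
  rw [this, along_smul (P.norm_dir _)]

theorem Propagates.along_pos (h : K.Propagates P δ a b) (v : Fin K.m) {t : ℝ}
    (ht : t ∈ Ico a b) :
    0 < along (P.dir (K.label v)) (K.pos (K.next v) t - K.pos v t) := by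
  obtain ⟨r, hr, he⟩ := h.oriented v t ht
  rwa [he, along_smul (P.norm_dir _)]

theorem Propagates.continuousOn_along (h : K.Propagates P δ a b) (v : Fin K.m) :
    ContinuousOn (fun t => along (P.dir (K.label v)) (K.pos (K.next v) t - K.pos v t))
      (Icc a b) :=
  (continuous_along _).comp_continuousOn ((h.continuousOn _).sub (h.continuousOn _))

/-- A limit of positive signed lengths: at time `b` an edge may have collapsed, but cannot be
reversed. -/
theorem Propagates.along_nonneg (h : K.Propagates P δ a b) (hab : a < b) (v : Fin K.m) :
    0 ≤ along (P.dir (K.label v)) (K.pos (K.next v) b - K.pos v b) := by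
  have hc := (h.continuousOn_along v b (right_mem_Icc.2 hab.le)).mono Ico_subset_Icc_self
  have : (𝓝[Ico a b] b).NeBot := by
    rw [nhdsWithin_Ico_eq_nhdsLT hab]; infer_instance
  exact ge_of_tendsto hc (eventually_mem_nhdsWithin.mono fun t ht => (h.along_pos v ht).le)

/-- Two edges of one wavefront polygon that are not parallel meet, at the end of a propagation
phase, only at an endpoint of one of them. -/
theorem Propagates.eq_endpoint_of_not_parallel (h : K.Propagates P δ a b) (hab : a < b)
    {v w : Fin K.m} (hvw : v ≠ w) (hc : K.next.SameCycle v w)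
    (h1 : P.dir (K.label w) ≠ P.dir (K.label v)) (h2 : P.dir (K.label w) ≠ -P.dir (K.label v))
    {z : ℂ} (hzv : z ∈ K.edge v b) (hzw : z ∈ K.edge w b) :
    z = K.pos v b ∨ z = K.pos (K.next v) b ∨ z = K.pos w b ∨ z = K.pos (K.next w) b := by
  -- A transversal crossing interior to both edges is stable, so it would already exist shortly
  -- before `b`, against simplicity.
  by_contra! hne
  obtain ⟨hn1, hn2, hn3, hn4⟩ := hne
  have hb : b ∈ Icc a b := right_mem_Icc.2 hab.le
  have hD := cross_ne_zero (P.norm_dir (K.label v)) (P.norm_dir (K.label w)) h1 h2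
  have interior : ∀ u : Fin K.m, z ∈ K.edge u b → z ≠ K.pos u b → z ≠ K.pos (K.next u) b →
      ∃ l : ℝ, z = K.pos u b + l • P.dir (K.label u) ∧ 0 < l ∧
        l < along (P.dir (K.label u)) (K.pos (K.next u) b - K.pos u b) := by
    intro u hz ha hb'
    have hs := h.sub_eq_along_smul u hb
    have h0 := h.along_nonneg hab u
    set r := along (P.dir (K.label u)) (K.pos (K.next u) b - K.pos u b)
    rw [edge, edgeSeg, segment_eq_image'] at hz
    obtain ⟨θ, hθ, hz⟩ := hz
    simp only [hs, smul_smul] at hz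
    have e1 : θ * r ≠ 0 := by
      intro e; rw [e, zero_smul, add_zero] at hz; exact ha hz.symm
    have e2 : θ * r ≠ r := by
      intro e; rw [e, ← hs, add_sub_cancel] at hz; exact hb' hz.symm
    refine ⟨θ * r, hz.symm, lt_of_le_of_ne (mul_nonneg hθ.1 h0) e1.symm, lt_of_le_of_ne ?_ e2⟩
    exact mul_le_of_le_one_left h0 hθ.2
  obtain ⟨l, hzl, hl0, hl⟩ := interior v hzv hn1 hn2
  obtain ⟨k, hzk, hk0, hk⟩ := interior w hzw hn3 hn4
  set d := P.dir (K.label v)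
  set e := P.dir (K.label w)
  -- By Cramer's rule, `L t` and `M t` locate the crossing of the two supporting lines, measured
  -- from the first vertex of each edge.
  set L : ℝ → ℝ := fun t => cross (K.pos w t - K.pos v t) e / cross d e
  set M : ℝ → ℝ := fun t => cross (K.pos w t - K.pos v t) d / cross d e
  have hdiff : K.pos w b - K.pos v b = l • d - k • e := by
    rw [sub_eq_sub_iff_add_eq_add, ← hzk, hzl, add_comm]
  have hLb : L b = l := by
    simp only [L, hdiff]
    rw [div_eq_iff hD]
    simp only [cross, Complex.sub_re, Complex.sub_im, Complex.smul_re, Complex.smul_im, smul_eq_mul]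
    ring
  have hMb : M b = k := by
    simp only [M, hdiff]
    rw [div_eq_iff hD]
    simp only [cross, Complex.sub_re, Complex.sub_im, Complex.smul_re, Complex.smul_im, smul_eq_mul]
    ring
  have hLc : ContinuousOn L (Icc a b) :=
    ((continuous_cross_left e).comp_continuousOn
      ((h.continuousOn w).sub (h.continuousOn v))).div_const _
  have hMc : ContinuousOn M (Icc a b) :=
    ((continuous_cross_left d).comp_continuousOn
      ((h.continuousOn w).sub (h.continuousOn v))).div_const _
  have toIco : ∀ f : ℝ → ℝ, ContinuousOn f (Icc a b) → Tendsto f (𝓝[Ico a b] b) (𝓝 (f b)) :=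
    fun f hf => (hf b hb).mono Ico_subset_Icc_self
  have hL := toIco _ hLc
  have hM := toIco _ hMc
  have hlen := toIco _ (h.continuousOn_along v)
  have klen := toIco _ (h.continuousOn_along w)
  rw [hLb] at hL
  rw [hMb] at hM
  have : (𝓝[Ico a b] b).NeBot := by
    rw [nhdsWithin_Ico_eq_nhdsLT hab]; infer_instance
  obtain ⟨t, ht, t1, t2, t3, t4⟩ := (eventually_mem_nhdsWithin.and
    ((hL.eventually_const_lt hl0).and ((hL.eventually_lt hlen hl).and
      ((hM.eventually_const_lt hk0).and (hM.eventually_lt klen hk))))).exists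
  have ht' := Ico_subset_Icc_self ht
  have hsv := h.sub_eq_along_smul v ht'
  have hsw := h.sub_eq_along_smul w ht'
  have hmeet : K.pos v t + L t • d = K.pos w t + M t • e := add_cross_smul_eq hD
  have hv := mem_segment_of_sub_eq_smul hsv t1.le t2
  have hw := mem_segment_of_sub_eq_smul hsw t3.le t4
  have cancel : ∀ {x d' : ℂ} {r : ℝ}, ‖d'‖ = 1 → x + r • d' = x → r = 0 := by
    intro x d' r hd' hx
    rcases smul_eq_zero.1 (add_eq_left.1 hx) with h0 | h0
    · exact h0
    · rw [h0, norm_zero] at hd'; exact absurd hd' zero_ne_one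
  -- Simplicity allows only a shared vertex, which is the start of one of the edges; then `M t` or
  -- `L t` would vanish.
  rcases (h.simple t ht).2 v w hc hvw _ ⟨hv, hmeet ▸ hw⟩ with ⟨-, hz⟩ | ⟨-, hz⟩
  · exact t3.ne' (cancel (P.norm_dir _) (hmeet.symm.trans hz))
  · exact t1.ne' (cancel (P.norm_dir _) hz)

/-- Every polygon of a propagating wavefront changes its direction somewhere. -/
theorem Propagates.exists_dir_ne (h : K.Propagates P δ a b) (hab : a < b) (u : Fin K.m) :
    ∃ k : ℕ, P.dir (K.label (K.next ((K.next ^ k) u))) ≠ P.dir (K.label ((K.next ^ k) u)) := by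
  by_contra! hall
  have hdir : ∀ k : ℕ, P.dir (K.label ((K.next ^ k) u)) = P.dir (K.label u) := by
    intro k
    induction k with
    | zero => rfl
    | succ k ih => rw [pow_succ', Equiv.Perm.mul_apply, hall, ih]
  -- With a constant direction, each edge advances strictly in that direction, yet the cycle closes
  -- up after `orderOf K.next` steps.
  have hmono : StrictMono fun k : ℕ => along (P.dir (K.label u)) (K.pos ((K.next ^ k) u) a) := by
    refine strictMono_nat_of_lt_succ fun k => ?_
    have := h.along_pos ((K.next ^ k) u) (left_mem_Ico.2 hab)
    rw [hdir, along_sub, sub_pos] at this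
    rwa [pow_succ', Equiv.Perm.mul_apply]
  have := hmono (orderOf_pos K.next)
  simp [pow_orderOf_eq_one] at this

/-- Every point of a portion common to two edges moving into each other shares this portion with
a vertex of the wavefront. -/
theorem Propagates.exists_vertex_mem_common (h : K.Propagates P δ a b) (hab : a < b)
    {v w : Fin K.m} {z : ℂ} (hz : z ∈ K.common P v w b) : ∃ u, K.pos u b ∈ K.common P v w b := by
  obtain ⟨hd, hv, hw⟩ := hz
  have hb : b ∈ Icc a b := right_mem_Icc.2 hab.le
  have hsw := h.sub_eq_along_smul w hb
  rw [hd, smul_neg, ← neg_smul, ← hd] at hsw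
  obtain ⟨y, hy, hyv, hyw⟩ := exists_endpoint_mem_inter (h.sub_eq_along_smul v hb) hsw hv hw
  rcases hy with rfl | rfl | rfl | rfl
  · exact ⟨_, hd, hyv, hyw⟩
  · exact ⟨_, hd, hyv, hyw⟩
  · exact ⟨_, hd, hyv, hyw⟩
  · exact ⟨_, hd, hyv, hyw⟩

theorem convex_common (K : KineticWavefront n) (P : SimplePolygon n) (v w : Fin K.m) (t : ℝ) :
    Convex ℝ (K.common P v w t) := by
  by_cases hd : P.dir (K.label w) = -P.dir (K.label v)
  · have : K.common P v w t = K.edge v t ∩ K.edge w t := by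
      ext z; exact ⟨fun h => h.2, fun h => ⟨hd, h⟩⟩
    rw [this]
    exact (convex_segment _ _).inter (convex_segment _ _)
  · have : K.common P v w t = ∅ := eq_empty_of_forall_notMem fun z h => hd h.1
    rw [this]
    exact convex_empty

theorem isClosed_common (K : KineticWavefront n) (P : SimplePolygon n) (v w : Fin K.m) (t : ℝ) :
    IsClosed (K.common P v w t) := by
  by_cases hd : P.dir (K.label w) = -P.dir (K.label v)
  · have : K.common P v w t = K.edge v t ∩ K.edge w t := by
      ext z; exact ⟨fun h => h.2, fun h => ⟨hd, h⟩⟩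
    rw [this]
    exact (isClosed_segment _ _).inter (isClosed_segment _ _)
  · have : K.common P v w t = ∅ := eq_empty_of_forall_notMem fun z h => hd h.1
    rw [this]
    exact isClosed_empty

end KineticWavefront

/-- A relation between consecutive vertices extends to whole cycles. -/
theorem rel_of_sameCycle {α : Type*} [Finite α] {f : Equiv.Perm α} {r : α → α → Prop}
    (refl : ∀ x, r x x) (trans : ∀ {x y z}, r x y → r y z → r x z) (h : ∀ x, r x (f x)) {x y : α}
    (hxy : f.SameCycle x y) : r x y := by
  obtain ⟨k, -, rfl⟩ := hxy.exists_pow_eq'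
  clear hxy
  induction k with
  | zero => exact refl x
  | succ k ih => rw [pow_succ', Equiv.Perm.mul_apply]; exact trans ih (h _)

/-! ### Connections across an event. -/

namespace KineticWavefront

theorem joinedIn_common {n : ℕ} {P : SimplePolygon n} {K : KineticWavefront n} {T : ℝ} {S : Set ℂ}
    {v w : Fin K.m} (hS : K.common P v w T ⊆ S) {y z : ℂ} (hy : y ∈ K.common P v w T)
    (hz : z ∈ K.common P v w T) : JoinedIn S y z :=
  JoinedIn.of_segment_subset (((K.convex_common P v w T).segment_subset hy hz).trans hS)

/-- Suppose that the vertices just before an event and the portions removed in it lie in `S`. If,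
after the event, the endpoints of every wavefront edge are joined in `S`, then so are the endpoints
of every wavefront edge just before the event. -/
theorem Event.joinedIn_next {n : ℕ} {P : SimplePolygon n} {K K' : KineticWavefront n} {T : ℝ}
    (he : Event P K K' T) {S : Set ℂ} (hpos : ∀ v, K.pos v T ∈ S)
    (hS : ∀ v w, K.common P v w T ⊆ S)
    (hnext : ∀ u, JoinedIn S (K'.pos u T) (K'.pos (K'.next u) T)) (v : Fin K.m) :
    JoinedIn S (K.pos v T) (K.pos (K.next v) T) := by
  obtain ⟨parent, -, hsub, hcov, hone, hcommon, -, -⟩ := he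
  set a := K.pos v T
  set b := K.pos (K.next v) T
  have haS : a ∈ S := hpos v
  rcases eq_or_ne a b with hab | hab
  · rw [← hab]; exact JoinedIn.refl haS
  have ha : a ∈ segment ℝ a b := left_mem_segment ℝ a b
  have hb : b ∈ segment ℝ a b := right_mem_segment ℝ a b
  -- a point known to be an endpoint of a child edge is joined to the first vertex of that edge
  have hend : ∀ u, ∀ x, x = K'.pos u T ∨ x = K'.pos (K'.next u) T →
      JoinedIn S (K'.pos u T) x := by
    rintro u x (rfl | rfl)
    · exact JoinedIn.refl (hnext u).source_mem
    · exact hnext u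
  have hchild : ∀ u, parent u = v → K'.edge u T ⊆ segment ℝ a b := by
    rintro u rfl; exact hsub u
  have hl : ∀ u, parent u = v → K'.pos u T ∈ segment ℝ a b := fun u hu =>
    hchild u hu (left_mem_segment ℝ _ _)
  have hr : ∀ u, parent u = v → K'.pos (K'.next u) T ∈ segment ℝ a b := fun u hu =>
    hchild u hu (right_mem_segment ℝ _ _)
  have hcom : ∀ w, K.common P v w T ⊆ segment ℝ a b := fun w z hz => hz.2.1
  let A : {u // parent u = v} ⊕ Fin K.m → Set ℂ :=
    Sum.elim (fun u => K'.edge u T) (fun w => K.common P v w T)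
  -- The interior of a child edge need not lie in `S`, so only its first vertex is required to be
  -- joined to `a`. A removed portion lies in `S` entirely. A child edge meets any other nontrivial
  -- piece in a single point, an endpoint of that child, so passing between pieces never uses the
  -- interior of a child.
  let good : {u // parent u = v} ⊕ Fin K.m → Prop :=
    Sum.elim (fun u => JoinedIn S a (K'.pos u T))
      (fun w => ∀ z ∈ K.common P v w T, JoinedIn S a z)
  have hmain : ∃ j, good j ∧ ¬ (A j).Subsingleton ∧ b ∈ A j := by
    refine exists_piece_of_chain (s := segment ℝ a b) (a := a) (b := b)
      (convex_segment a b).isPreconnected ⟨a, ha, b, hb, hab⟩ ?_ ?_ good ?_ ha hb ?_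
    · rintro (u | w)
      · exact isClosed_segment _ _
      · exact K.isClosed_common P v w T
    · intro x hx
      rcases hcov v hab x hx with ⟨u, hu, hxu⟩ | ⟨w, hxw⟩
      · exact ⟨Sum.inl ⟨u, hu⟩, hxu⟩
      · exact ⟨Sum.inr w, hxw⟩
    · rintro (⟨u, hu⟩ | w) (⟨u', hu'⟩ | w') hg hj hk ⟨x, -, hxj, hxk⟩
      · rcases eq_or_ne u u' with rfl | hne
        · exact hg
        have hI := hone u u' hne (hu.trans hu'.symm)
        have e := eq_endpoint_of_inter_subsingleton (convex_segment _ _) (hchild u' hu') hk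
          (hl u hu) (hr u hu) hI hxk hxj
        have e' := eq_endpoint_of_inter_subsingleton (convex_segment _ _) (hchild u hu) hj
          (hl u' hu') (hr u' hu') (by rw [inter_comm]; exact hI) hxj hxk
        exact (JoinedIn.trans hg (hend u x e)).trans (hend u' x e').symm
      · have hI := hcommon u w'
        rw [hu] at hI
        have e := eq_endpoint_of_inter_subsingleton (K.convex_common P v w' T) (hcom w') hk
          (hl u hu) (hr u hu) hI hxk hxj
        intro z hz
        exact (JoinedIn.trans hg (hend u x e)).trans (joinedIn_common (hS _ _) hxk hz)
      · have hI := hcommon u' w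
        rw [hu'] at hI
        have e := eq_endpoint_of_inter_subsingleton (K.convex_common P v w T) (hcom w) hj
          (hl u' hu') (hr u' hu') hI hxj hxk
        exact (hg x hxj).trans (hend u' x e).symm
      · intro z hz
        exact (hg x hxj).trans (joinedIn_common (hS _ _) hxk hz)
    · rintro (⟨u, hu⟩ | w) - haj
      · exact (hend u a (eq_endpoint_of_endpoint_mem (hl u hu) (hr u hu) haj)).symm
      · exact fun z hz => joinedIn_common (hS _ _) haj hz
  obtain ⟨⟨u, hu⟩ | w, hg, -, hbj⟩ := hmain
  · refine JoinedIn.trans hg (hend u b ?_)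
    refine eq_endpoint_of_endpoint_mem (b := a) ?_ ?_ hbj
    · rw [segment_symm]; exact hl u hu
    · rw [segment_symm]; exact hr u hu
  · exact hg b hbj

end KineticWavefront

/-! ### Path-connectedness of the whole skeleton. -/

namespace WavefrontPropagation

variable {n : ℕ} {P : SimplePolygon n} {δ : Fin n → NNReal} (W : WavefrontPropagation P δ)

theorem pos_mem_skeleton {i : ℕ} (hi : i < W.N) (v : Fin (W.wave i).m) {s : ℝ}
    (hs : s ∈ Icc (W.time i) (W.time (i + 1))) : (W.wave i).pos v s ∈ W.skeleton :=
  mem_iUnion.2 ⟨s, Or.inl ⟨i, hi, v, s, hs, le_rfl, rfl⟩⟩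

theorem common_subset_skeleton {i : ℕ} (hi : i < W.N) (v w : Fin (W.wave i).m) :
    (W.wave i).common P v w (W.time (i + 1)) ⊆ W.skeleton :=
  fun _ hz => mem_iUnion.2 ⟨W.time (i + 1), Or.inr ⟨i, hi, le_rfl, v, w, hz⟩⟩

theorem joinedIn_common {i : ℕ} (hi : i < W.N) {v w : Fin (W.wave i).m} {y z : ℂ}
    (hy : y ∈ (W.wave i).common P v w (W.time (i + 1)))
    (hz : z ∈ (W.wave i).common P v w (W.time (i + 1))) : JoinedIn W.skeleton y z :=
  KineticWavefront.joinedIn_common (W.common_subset_skeleton hi v w) hy hz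

theorem joinedIn_trace {i : ℕ} (hi : i < W.N) (v : Fin (W.wave i).m) {s s' : ℝ}
    (hs : s ∈ Icc (W.time i) (W.time (i + 1))) (hs' : s' ∈ Icc (W.time i) (W.time (i + 1))) :
    JoinedIn W.skeleton ((W.wave i).pos v s) ((W.wave i).pos v s') := by
  have hpc : IsPathConnected ((W.wave i).pos v '' Icc (W.time i) (W.time (i + 1))) :=
    ((convex_Icc _ _).isPathConnected ⟨s, hs⟩).image' ((W.propagates i hi).continuousOn v)
  refine (hpc.joinedIn _ (mem_image_of_mem _ hs) _ (mem_image_of_mem _ hs')).mono ?_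
  rintro _ ⟨r, hr, rfl⟩
  exact W.pos_mem_skeleton hi v hr

/-- The endpoints of every edge of a new wavefront are joined in the skeleton. -/
theorem joinedIn_next {i : ℕ} (hi : i ≤ W.N) (v : Fin (W.wave i).m) :
    JoinedIn W.skeleton ((W.wave i).pos v (W.time i))
      ((W.wave i).pos ((W.wave i).next v) (W.time i)) := by
  induction hi using Nat.decreasingInduction with
  | self =>
    have h := v.isLt
    have := W.finish
    omega
  | of_succ i hi ih =>
    -- Follow one endpoint forwards to the event, cross over there, and follow the trace of the
    -- other endpoint back.
    have hle := (W.time_lt i hi).le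
    exact ((W.joinedIn_trace hi v (left_mem_Icc.2 hle) (right_mem_Icc.2 hle)).trans
      ((W.event i hi).joinedIn_next (fun v => W.pos_mem_skeleton hi v (right_mem_Icc.2 hle))
        (W.common_subset_skeleton hi) ih v)).trans
      (W.joinedIn_trace hi _ (right_mem_Icc.2 hle) (left_mem_Icc.2 hle))

theorem joinedIn_of_sameCycle {i : ℕ} (hi : i < W.N) {v w : Fin (W.wave i).m}
    (h : (W.wave i).next.SameCycle v w) :
    JoinedIn W.skeleton ((W.wave i).pos v (W.time i)) ((W.wave i).pos w (W.time i)) :=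
  rel_of_sameCycle
    (r := fun x y => JoinedIn W.skeleton ((W.wave i).pos x (W.time i)) ((W.wave i).pos y (W.time i)))
    (fun x => JoinedIn.refl
      (W.pos_mem_skeleton hi x (left_mem_Icc.2 (W.time_lt i hi).le)))
    (fun h h' => JoinedIn.trans h h') (fun x => W.joinedIn_next hi.le x) h

/-- Every vertex of a wavefront after an event is joined in the skeleton to a vertex of the
wavefront before the event. -/
theorem exists_joinedIn_of_event {i : ℕ} (hi : i < W.N) (u₀ : Fin (W.wave (i + 1)).m) :
    ∃ v, JoinedIn W.skeleton ((W.wave i).pos v (W.time (i + 1)))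
      ((W.wave (i + 1)).pos u₀ (W.time (i + 1))) := by
  have hi' : i + 1 < W.N := by
    refine lt_of_le_of_ne hi fun h => ?_
    have h1 := u₀.isLt
    have h2 := W.finish
    rw [← h] at h2
    omega
  obtain ⟨parent, hlabel, hsub, -, -, -, hcyc, hpar⟩ := W.event i hi
  have hlt := W.time_lt i hi
  have hT := right_mem_Icc.2 hlt.le
  -- The given vertex may have a straight angle, and then its two parent edges need not determine
  -- it; a genuine corner of the same polygon is used instead.
  obtain ⟨k, hk⟩ := (W.propagates (i + 1) hi').exists_dir_ne (W.time_lt (i + 1) hi') u₀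
  set u := ((W.wave (i + 1)).next ^ k) u₀
  set u' := (W.wave (i + 1)).next u
  have hz : (W.wave (i + 1)).pos u' (W.time (i + 1)) ∈
      (W.wave i).edge (parent u) (W.time (i + 1)) := hsub u (right_mem_segment ℝ _ _)
  have hz' : (W.wave (i + 1)).pos u' (W.time (i + 1)) ∈
      (W.wave i).edge (parent u') (W.time (i + 1)) := hsub u' (left_mem_segment ℝ _ _)
  have hu : (W.wave (i + 1)).next.SameCycle u u' := ⟨1, by simp [u']⟩
  have hu₀ : (W.wave (i + 1)).next.SameCycle u' u₀ := by
    refine (Equiv.Perm.SameCycle.trans ⟨(k : ℤ), ?_⟩ hu).symm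
    simp [u]
  have hJ := W.joinedIn_of_sameCycle hi' hu₀
  rw [hlabel, hlabel] at hk
  by_cases hopp : P.dir ((W.wave i).label (parent u')) = -P.dir ((W.wave i).label (parent u))
  · have hzc : (W.wave (i + 1)).pos u' (W.time (i + 1)) ∈
        (W.wave i).common P (parent u) (parent u') (W.time (i + 1)) := ⟨hopp, hz, hz'⟩
    obtain ⟨v, hv⟩ := (W.propagates i hi).exists_vertex_mem_common hlt hzc
    exact ⟨v, (W.joinedIn_common hi hv hzc).trans hJ⟩
  · have hvert : ∃ v, (W.wave (i + 1)).pos u' (W.time (i + 1)) =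
        (W.wave i).pos v (W.time (i + 1)) := by
      rcases (W.propagates i hi).eq_endpoint_of_not_parallel hlt (hpar u).symm (hcyc _ _ hu)
        hk hopp hz hz' with h | h | h | h
      exacts [⟨_, h⟩, ⟨_, h⟩, ⟨_, h⟩, ⟨_, h⟩]
    obtain ⟨v, hv⟩ := hvert
    exact ⟨v, hv ▸ hJ⟩

theorem N_pos : 0 < W.N := by
  rcases Nat.eq_zero_or_pos W.N with h | h
  · obtain ⟨φ, -⟩ := W.start
    have h0 := W.finish
    rw [h] at h0
    have := (φ ⟨0, by have := P.three_le; omega⟩).isLt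
    omega
  · exact h

/-- All wavefront vertices are joined in the skeleton to a common point. -/
theorem exists_forall_joinedIn : ∃ o : ℂ, ∀ i < W.N, ∀ v,
    JoinedIn W.skeleton o ((W.wave i).pos v (W.time i)) := by
  obtain ⟨φ, hφ⟩ := W.start
  have h3 := P.three_le
  refine ⟨(W.wave 0).pos (φ ⟨0, by omega⟩) (W.time 0), fun i => ?_⟩
  induction i with
  | zero =>
    intro h0 v
    obtain ⟨j, rfl⟩ := φ.surjective v
    -- The initial wavefront is the single polygon `P`, so one walk around it reaches every vertex.
    have hc : (finRotate n).SameCycle ⟨0, by omega⟩ j := by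
      have hsupp : ∀ x, finRotate n x ≠ x := fun x => by
        rw [← Equiv.Perm.mem_support, support_finRotate_of_le (by omega)]
        exact Finset.mem_univ _
      exact (isCycle_finRotate_of_le (by omega)).sameCycle (hsupp _) (hsupp _)
    refine rel_of_sameCycle (r := fun x y => JoinedIn W.skeleton
      ((W.wave 0).pos (φ x) (W.time 0)) ((W.wave 0).pos (φ y) (W.time 0)))
      (fun x => JoinedIn.refl (W.pos_mem_skeleton h0 _ (left_mem_Icc.2 (W.time_lt 0 h0).le)))
      (fun h h' => JoinedIn.trans h h') (fun x => ?_) hc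
    rw [← (hφ x).1]
    exact W.joinedIn_next h0.le _
  | succ i ih =>
    intro hi u
    have hi' : i < W.N := by omega
    have hle := (W.time_lt i hi').le
    obtain ⟨v, hv⟩ := W.exists_joinedIn_of_event hi' u
    exact ((ih hi' v).trans
      (W.joinedIn_trace hi' v (left_mem_Icc.2 hle) (right_mem_Icc.2 hle))).trans hv

/-- The straight skeleton is path-connected. -/
theorem isPathConnected_skeleton : IsPathConnected W.skeleton := by
  obtain ⟨o, ho⟩ := W.exists_forall_joinedIn
  have hvert : ∀ i < W.N, ∀ v, ∀ s ∈ Icc (W.time i) (W.time (i + 1)),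
      JoinedIn W.skeleton o ((W.wave i).pos v s) := fun i hi v s hs =>
    (ho i hi v).trans (W.joinedIn_trace hi v (left_mem_Icc.2 (W.time_lt i hi).le) hs)
  refine ⟨o, ?_, fun {z} hz => ?_⟩
  · obtain ⟨φ, -⟩ := W.start
    exact (ho 0 W.N_pos (φ ⟨0, by have := P.three_le; omega⟩)).source_mem
  · obtain ⟨t, ⟨i, hi, v, s, hs, -, rfl⟩ | ⟨i, hi, -, v, w, hz⟩⟩ := mem_iUnion.1 hz
    · exact hvert i hi v s hs
    · have hlt := W.time_lt i hi
      obtain ⟨u, hu⟩ := (W.propagates i hi).exists_vertex_mem_common hlt hz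
      exact (hvert i hi u _ (right_mem_Icc.2 hlt.le)).trans (W.joinedIn_common hi hu hz)

end WavefrontPropagation

end StraightSkeleton

theorem mainTheorem4 {n : ℕ} (P : StraightSkeleton.SimplePolygon n) (δ : Fin n → NNReal)
    (W : StraightSkeleton.WavefrontPropagation P δ) (t : ℝ) (ht : 0 ≤ t)
    (p q : ℂ) (hp : p ∈ W.skeletonUntil t) (hq : q ∈ W.skeletonUntil t)
    (hpq : JoinedIn (W.skeletonUntil t ∪ W.wavefront t) p q) :
    JoinedIn W.skeleton p q :=
  W.isPathConnected_skeleton.joinedIn p (Set.mem_iUnion.2 ⟨t, hp⟩) q (Set.mem_iUnion.2 ⟨t, hq⟩)
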